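/- Let $\mathbb T=\mathbb R/\mathbb Z$ and fix $\varepsilon>0$. Put $c(\varepsilon)=1/\sqrt{2\cosh(\varepsilon)-2}$. For $\alpha\in\mathbb T$ define the boundary function $\mathscr B_\alpha:[0,\infty)\to\mathbb R$ by $$ \mathscr B_\alpha(r)=\inf_{j\ge 1}\,u_{\alpha,j}(r),\qquad u_{\alpha,j}(r)=c(\varepsilon)\sqrt{4\sin^2(\pi j\alpha)\,r^2+j^2}, $$ where $j$ ranges over the positive integers. (For irrational $\alpha$, $t=\mathscr B_\alpha(r)$ is the boundary of the Margulis region, at scale $\varepsilon$, of the screw translation $(r,\theta,z,t)\mapsto(r,\theta+\alpha,z+1,t)$ of hyperbolic $4$-space.) Then for Lebesgue-almost every irrational $\alpha\in\mathbb T$, $$ \lim_{r\to\infty}\frac{\log\mathscr B_\alpha(r)}{\log r}=\frac12 . $$ -/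

import Mathlib

open Filter Topology MeasureTheory

noncomputable section

namespace MargulisCusp

/-- The function `x ↦ sin² (π x)` on `ℝ` has period `1`. -/
theorem periodic_sin_sq : Function.Periodic (fun x : ℝ => Real.sin (Real.pi * x) ^ 2) 1 := by
  intro x
  simp only [mul_add, mul_one, Real.sin_add_pi, neg_sq]

/-- The function `x ↦ sin² (π x)` on the circle `ℝ / ℤ`. -/
def sinSq : UnitAddCircle → ℝ := periodic_sin_sq.lift

@[simp]
theorem sinSq_coe (x : ℝ) : sinSq (x : UnitAddCircle) = Real.sin (Real.pi * x) ^ 2 := rfl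

/-- A point of `ℝ / ℤ` is irrational if it is the class of an irrational real number
(equivalently, all its representatives are irrational). -/
def IsIrrational (α : UnitAddCircle) : Prop :=
  ∃ x : ℝ, Irrational x ∧ (x : UnitAddCircle) = α

/-- The constant `c(ε) = 1 / √(2 cosh ε - 2)`. -/
def c (ε : ℝ) : ℝ := 1 / √(2 * Real.cosh ε - 2)

/-- `u_{α,j}(r) = c(ε) √(4 sin² (π j α) r² + j²)`. -/
def u (ε : ℝ) (α : UnitAddCircle) (j : ℕ) (r : ℝ) : ℝ :=
  c ε * √(4 * sinSq (j • α) * r ^ 2 + (j : ℝ) ^ 2)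

/-- The boundary function `𝓑_α(r) = inf_{j ≥ 1} u_{α,j}(r)` of the Margulis region of the screw
translation with rotation angle `α`. -/
def boundaryFun (ε : ℝ) (α : UnitAddCircle) (r : ℝ) : ℝ :=
  ⨅ j : ℕ+, u ε α j r

end MargulisCusp

end

namespace MargulisCusp

/-! Write ‖t‖ for the distance from t to the nearest integer. Since |sin πt| is comparable to ‖t‖,
`u` is comparable to max(‖jx‖ r, j). Dirichlet gives j ≤ √r with ‖jx‖ ≤ 1/√r, so the infimum is
O(√r) for every x (`boundaryFun_le`). Conversely, almost every x is `LiouvilleWith` no p > 2, so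
‖jx‖ ≥ j^(1-p) for all large j, whence max(‖jx‖ r, j) ≥ r^(1/p) (`rpow_le_u`). The finitely many
remaining j grow linearly in r because x is irrational. Finally p tends to 2. -/

open Real in
/-- `sin² (π t)` only depends on the distance of `t` to the nearest integer. -/
theorem sin_sq_pi_mul_eq (t : ℝ) : sin (π * t) ^ 2 = sin (π * (t - round t)) ^ 2 := by
  have h := periodic_sin_sq.sub_int_mul_eq (x := t) (round t)
  simpa only [mul_one] using h.symm

open Real in
theorem sin_sq_pi_mul_le (t : ℝ) : sin (π * t) ^ 2 ≤ π ^ 2 * (t - round t) ^ 2 := by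
  rw [sin_sq_pi_mul_eq, ← mul_pow]
  exact sq_le_sq.2 abs_sin_le_abs

open Real in
theorem two_mul_abs_sub_round_le (t : ℝ) : 2 * |t - round t| ≤ |sin (π * t)| := by
  have h1 : |sin (π * t)| = |sin (π * (t - round t))| :=
    (sq_eq_sq_iff_abs_eq_abs _ _).1 (sin_sq_pi_mul_eq t)
  have h2 : |π * (t - round t)| = π * |t - round t| := by rw [abs_mul, abs_of_pos pi_pos]
  rw [h1]
  have h3 := mul_abs_le_abs_sin (x := π * (t - round t))
    (by rw [h2]; nlinarith [abs_sub_round t, pi_pos])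
  rw [h2] at h3
  calc 2 * |t - round t| = 2 / π * (π * |t - round t|) := by field_simp
    _ ≤ _ := h3

theorem c_pos {ε : ℝ} (hε : 0 < ε) : 0 < c ε := by
  have : 1 < Real.cosh ε := Real.one_lt_cosh.2 hε.ne'
  exact one_div_pos.2 (Real.sqrt_pos.2 (by linarith))

theorem u_coe (ε : ℝ) (x : ℝ) (j : ℕ) (r : ℝ) :
    u ε (x : UnitAddCircle) j r =
      c ε * √(4 * Real.sin (Real.pi * (j * x)) ^ 2 * r ^ 2 + (j : ℝ) ^ 2) := by
  rw [u, ← AddCircle.coe_nsmul, sinSq_coe, nsmul_eq_mul]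

theorem u_nonneg {ε : ℝ} (hε : 0 < ε) (α : UnitAddCircle) (j : ℕ) (r : ℝ) : 0 ≤ u ε α j r :=
  mul_nonneg (c_pos hε).le (Real.sqrt_nonneg _)

/-- Upper bound for the boundary function, from Dirichlet's approximation theorem. -/
theorem boundaryFun_le {ε : ℝ} (hε : 0 < ε) (x : ℝ) {r : ℝ} (hr : 1 ≤ r) :
    boundaryFun ε (x : UnitAddCircle) r ≤ c ε * √(4 * Real.pi ^ 2 + 1) * r ^ (1 / 2 : ℝ) := by
  have hs : 1 ≤ √r := Real.one_le_sqrt.2 hr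
  have hr0 : 0 < r := by linarith
  -- Denominators up to ⌊√r⌋ balance the two terms: both k² and ‖kx‖² r² are then at most r.
  obtain ⟨k, hk, hkN, hkx⟩ := Real.exists_nat_abs_mul_sub_round_le x (Nat.floor_pos.2 hs)
  have hkr : (k : ℝ) ≤ √r := (Nat.cast_le.2 hkN).trans (Nat.floor_le (by positivity))
  have hd : |k * x - round (k * x)| ≤ 1 / √r :=
    hkx.trans (one_div_le_one_div_of_le (by positivity) (Nat.lt_floor_add_one _).le)
  have hd2 : (k * x - round (k * x)) ^ 2 ≤ 1 / r := by
    rw [← sq_abs]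
    calc _ ≤ (1 / √r) ^ 2 := pow_le_pow_left₀ (abs_nonneg _) hd 2
      _ = 1 / r := by rw [div_pow, Real.sq_sqrt hr0.le, one_pow]
  have hk2 : (k : ℝ) ^ 2 ≤ r := by
    calc _ ≤ √r ^ 2 := pow_le_pow_left₀ (by positivity) hkr 2
      _ = r := Real.sq_sqrt hr0.le
  calc boundaryFun ε (x : UnitAddCircle) r ≤ u ε (x : UnitAddCircle) k r :=
        ciInf_le (f := fun j : ℕ+ => u ε (x : UnitAddCircle) j r)
          ⟨0, Set.forall_mem_range.2 fun j => u_nonneg hε _ _ _⟩ ⟨k, hk⟩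
    _ ≤ c ε * √((4 * Real.pi ^ 2 + 1) * r) := by
        rw [u_coe]
        refine mul_le_mul_of_nonneg_left (Real.sqrt_le_sqrt ?_) (c_pos hε).le
        have h1 := (sin_sq_pi_mul_le (k * x)).trans
          (mul_le_mul_of_nonneg_left hd2 (sq_nonneg Real.pi))
        have h2 := mul_le_mul_of_nonneg_right h1 (sq_nonneg r)
        have h3 : Real.pi ^ 2 * (1 / r) * r ^ 2 = Real.pi ^ 2 * r := by field_simp
        linarith
    _ = _ := by rw [Real.sqrt_mul (by positivity), ← Real.sqrt_eq_rpow, mul_assoc]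

theorem le_u_of_le {ε : ℝ} (hε : 0 < ε) (x : ℝ) (j : ℕ) {r y : ℝ}
    (h : y ≤ 2 * |Real.sin (Real.pi * (j * x))| * r ∨ y ≤ j) :
    c ε * y ≤ u ε (x : UnitAddCircle) j r := by
  rw [u_coe]
  refine mul_le_mul_of_nonneg_left ?_ (c_pos hε).le
  rcases h with h | h
  · refine h.trans (Real.le_sqrt_of_sq_le ?_)
    rw [mul_pow, mul_pow, sq_abs]
    nlinarith [sq_nonneg (j : ℝ)]
  · exact h.trans (Real.le_sqrt_of_sq_le (le_add_of_nonneg_left (by positivity)))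

/-- If `x` is badly approximable with exponent `p` at denominator `j`, then `u_{x,j}(r)` is at
least `c(ε) r ^ (1 / p)`. -/
theorem rpow_le_u {ε : ℝ} (hε : 0 < ε) {x p : ℝ} (hp : 1 < p) {j : ℕ} (hj : 0 < j)
    (hx : ∀ m : ℤ, 1 / (j : ℝ) ^ p ≤ |x - m / j|) {r : ℝ} (hr : 0 < r) :
    c ε * r ^ (1 / p) ≤ u ε (x : UnitAddCircle) j r := by
  have hj' : (0 : ℝ) < j := Nat.cast_pos.2 hj
  have hp0 : 0 < p := by linarith
  -- The terms j^(1-p) r and j cross at j = r^(1/p): beyond it j suffices, before it the sine term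
  -- does.
  refine le_u_of_le hε x j ((le_or_gt (r ^ (1 / p)) j).symm.imp (fun h => ?_) id)
  have h1 : (j : ℝ) ^ (1 - p) ≤ |j * x - round (j * x)| := by
    have h := mul_le_mul_of_nonneg_left (hx (round (j * x))) hj'.le
    rw [← abs_of_pos hj', ← abs_mul, abs_of_pos hj', mul_sub, mul_div_cancel₀ _ hj'.ne'] at h
    rwa [Real.rpow_sub hj', Real.rpow_one, div_eq_mul_one_div]
  have h2 : (r ^ (1 / p)) ^ (1 - p) ≤ (j : ℝ) ^ (1 - p) :=
    Real.rpow_le_rpow_of_nonpos hj' h.le (by linarith)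
  have h3 : (r ^ (1 / p)) ^ (1 - p) * r = r ^ (1 / p) := by
    rw [← Real.rpow_mul hr.le]
    nth_rewrite 2 [← Real.rpow_one r]
    rw [← Real.rpow_add hr]
    congr 1
    field_simp
    ring
  have h4 := two_mul_abs_sub_round_le (j * x)
  rw [← h3]
  refine mul_le_mul_of_nonneg_right ?_ hr.le
  linarith [abs_nonneg (j * x - round (j * x))]

/-- For fixed `j`, the function `u_{x,j}` eventually dominates every `c(ε) r ^ s` with `s < 1`. -/
theorem eventually_rpow_le_u {ε : ℝ} (hε : 0 < ε) {x : ℝ} (hx : Irrational x) {j : ℕ}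
    (hj : 0 < j) {s : ℝ} (hs : s < 1) :
    ∀ᶠ r : ℝ in atTop, c ε * r ^ s ≤ u ε (x : UnitAddCircle) j r := by
  have hne : 0 < 2 * |Real.sin (Real.pi * (j * x))| := by
    have h := two_mul_abs_sub_round_le (j * x)
    have h0 : 0 < |j * x - round (j * x)| :=
      abs_pos.2 (sub_ne_zero.2 ((hx.natCast_mul hj.ne').ne_int _))
    linarith
  have ho := tendsto_rpow_atTop (sub_pos.2 hs)
  filter_upwards [eventually_gt_atTop 0,
    ho.eventually_ge_atTop (2 * |Real.sin (Real.pi * (j * x))|)⁻¹] with r hr h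
  refine le_u_of_le hε x j (Or.inl ?_)
  have h1 := (inv_le_iff_one_le_mul₀' hne).1 h
  have h2 := mul_le_mul_of_nonneg_right h1 (Real.rpow_nonneg hr.le s)
  rwa [one_mul, mul_assoc, ← Real.rpow_add hr, sub_add_cancel, Real.rpow_one] at h2

theorem eventually_rpow_le_boundaryFun {ε : ℝ} (hε : 0 < ε) {x : ℝ} (hx : Irrational x) {p : ℝ}
    (hp : 1 < p) (hxp : ¬ LiouvilleWith p x) :
    ∀ᶠ r : ℝ in atTop, c ε * r ^ (1 / p) ≤ boundaryFun ε (x : UnitAddCircle) r := by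
  have h1 : ∀ᶠ n : ℕ in atTop, ∀ m : ℤ, 1 / (n : ℝ) ^ p ≤ |x - m / n| := by
    by_contra hcon
    refine hxp ⟨1, (not_eventually.1 hcon).mono fun n hn => ?_⟩
    obtain ⟨m, hm⟩ := not_forall.1 hn
    refine ⟨m, ?_, not_le.1 hm⟩
    simpa using hx.ne_rat (m / n)
  obtain ⟨N, hN⟩ := eventually_atTop.1 h1
  have hp1 : 1 / p < 1 := (div_lt_one (by linarith)).2 hp
  have h2 : ∀ᶠ r : ℝ in atTop, ∀ j ∈ Finset.Ioo 0 N,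
      c ε * r ^ (1 / p) ≤ u ε (x : UnitAddCircle) j r :=
    (Finset.eventually_all _).2 fun j hj =>
      eventually_rpow_le_u hε hx (Finset.mem_Ioo.1 hj).1 hp1
  filter_upwards [h2, eventually_gt_atTop 0] with r hr hr0
  refine le_ciInf fun j => ?_
  rcases lt_or_ge (j : ℕ) N with h | h
  · exact hr j (Finset.mem_Ioo.2 ⟨j.pos, h⟩)
  · exact rpow_le_u hε hp j.pos (hN j h) hr0

theorem tendsto_log_mul_rpow_div_log {K : ℝ} (hK : 0 < K) (s : ℝ) :
    Tendsto (fun r : ℝ => Real.log (K * r ^ s) / Real.log r) atTop (𝓝 s) := by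
  have h := (Real.tendsto_log_atTop.const_div_atTop (Real.log K)).add_const s
  rw [zero_add] at h
  refine h.congr' ?_
  filter_upwards [eventually_gt_atTop 1] with r hr
  have hl := Real.log_pos hr
  rw [Real.log_mul hK.ne' (by positivity), Real.log_rpow (by linarith)]
  field_simp

theorem tendsto_log_boundaryFun {ε : ℝ} (hε : 0 < ε) {x : ℝ} (hx : Irrational x)
    (hL : ∀ p > (2 : ℝ), ¬ LiouvilleWith p x) :
    Tendsto (fun r : ℝ => Real.log (boundaryFun ε (x : UnitAddCircle) r) / Real.log r)
      atTop (𝓝 (1 / 2)) := by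
  have hc := c_pos hε
  have hlow : ∀ p > (2 : ℝ), ∀ᶠ r : ℝ in atTop,
      c ε * r ^ (1 / p) ≤ boundaryFun ε (x : UnitAddCircle) r := fun p hp =>
    eventually_rpow_le_boundaryFun hε hx (by linarith) (hL p hp)
  refine tendsto_order.2 ⟨fun a ha => ?_, fun a ha => ?_⟩
  -- Taking s positive as well as above a makes p = 1/s an admissible exponent.
  · obtain ⟨s, hs, hs2⟩ := exists_between (max_lt ha (by norm_num : (0 : ℝ) < 1 / 2))
    have hs0 : 0 < s := (le_max_right _ _).trans_lt hs
    have hp : 2 < 1 / s := (lt_one_div two_pos hs0).2 hs2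
    filter_upwards [hlow _ hp, eventually_gt_atTop 1,
      (tendsto_log_mul_rpow_div_log hc s).eventually_const_lt ((le_max_left _ _).trans_lt hs)]
      with r hr hr1 h
    rw [one_div_one_div] at hr
    have hl := Real.log_pos hr1
    exact h.trans_le (div_le_div_of_nonneg_right (Real.log_le_log (by positivity) hr) hl.le)
  -- The exponent 3 is arbitrary: the lower bound only serves to make the argument of the logarithm
  -- positive.
  · filter_upwards [hlow 3 (by norm_num), eventually_gt_atTop 1, (tendsto_log_mul_rpow_div_log
      (K := c ε * √(4 * Real.pi ^ 2 + 1)) (by positivity) (1 / 2)).eventually_lt_const ha]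
      with r hr hr1 h
    have hl := Real.log_pos hr1
    exact (div_le_div_of_nonneg_right (Real.log_le_log (lt_of_lt_of_le (by positivity) hr)
      (boundaryFun_le hε x hr1.le)) hl.le).trans_lt h

/-- Almost every point of the circle has a representative that is not Liouville with any
exponent `p > 2`. -/
theorem ae_exists_coe_eq_and_not_liouvilleWith :
    ∀ᵐ α ∂(volume : Measure UnitAddCircle),
      ∃ x : ℝ, (x : UnitAddCircle) = α ∧ ∀ p > (2 : ℝ), ¬ LiouvilleWith p x := by
  -- The representative in (0, 1] transports the almost-everywhere statement from the line to the
  -- circle.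
  have h := (measurePreserving_subtype_coe measurableSet_Ioc).comp
    (AddCircle.measurePreserving_equivIoc 1 (a := 0))
  have h2 := h.quasiMeasurePreserving.ae (ae_restrict_of_ae ae_not_liouvilleWith)
  filter_upwards [h2] with α hα
  exact ⟨_, AddCircle.coe_equivIoc, hα⟩

theorem IsIrrational.irrational_of_coe {x : ℝ} (h : IsIrrational (x : UnitAddCircle)) :
    Irrational x := by
  obtain ⟨y, hy, hyx⟩ := h
  obtain ⟨n, hn⟩ := (AddCircle.coe_eq_zero_iff (1 : ℝ) (x := x - y)).1
    (by rw [AddCircle.coe_sub, hyx, sub_self])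
  rw [zsmul_eq_mul, mul_one] at hn
  rw [← sub_add_cancel x y, ← hn]
  exact hy.intCast_add n

end MargulisCusp

theorem mainTheorem11 (ε : ℝ) (hε : 0 < ε) :
    ∀ᵐ α ∂(volume : Measure UnitAddCircle), MargulisCusp.IsIrrational α →
      Tendsto (fun r : ℝ => Real.log (MargulisCusp.boundaryFun ε α r) / Real.log r)
        atTop (𝓝 (1 / 2)) := by
  filter_upwards [MargulisCusp.ae_exists_coe_eq_and_not_liouvilleWith] with α hα hirr
  obtain ⟨x, rfl, hx⟩ := hα
  exact MargulisCusp.tendsto_log_boundaryFun hε hirr.irrational_of_coe hx
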